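/- Let $\mathcal H,\mathcal K$ be finite dimensional complex Hilbert spaces and let $\mathcal A\subseteq B(\mathcal H)$, $\mathcal B\subseteq B(\mathcal K)$ be $C^*$-algebras containing the identity operators. A density operator in $\mathcal A$ is a positive $\sigma\in\mathcal A$ with $\mathrm{Tr}\,\sigma=1$; $\mathrm{supp}\,\sigma$ denotes its support projection. For a linear map $T:\mathcal A\to\mathcal B$ let $T^*:\mathcal B\to\mathcal A$ be its adjoint with respect to the Hilbert-Schmidt inner products $\langle a,b\rangle=\mathrm{Tr}\,a^*b$. A linear map $\Phi$ between such algebras is a unital Schwarz map if $\Phi(I)=I$ and $\Phi(a^*a)\ge\Phi(a)^*\Phi(a)$ for all $a$. For a density operator $\sigma\in\mathcal A$, with $q=\mathrm{supp}\,\sigma$ and $q_0=\mathrm{supp}\,T(\sigma)$, let $T_\sigma:q\mathcal A q\to q_0\mathcal B q_0$ be the map $$T_\sigma(b)=T(\sigma)^{-1/2}\,T(\sigma^{1/2}b\,\sigma^{1/2})\,T(\sigma)^{-1/2},\qquad b\in q\mathcal A q,$$ where $T(\sigma)^{-1/2}$ is the inverse of $T(\sigma)^{1/2}$ on the support of $T(\sigma)$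 and $0$ on its orthogonal complement. Let $\mathcal S$ be a set of density operators in $\mathcal A$ and let $T:\mathcal A\to\mathcal B$ be a linear map such that $T^*$ is a unital Schwarz map. Call $T$ reversible for $\mathcal S$ if there is a linear map $S:\mathcal B\to\mathcal A$ such that $S^*$ is a unital Schwarz map and $S(T(\sigma))=\sigma$ for all $\sigma\in\mathcal S$. Suppose that $\rho\in\mathcal S$ is such that $\rho$ and $T(\rho)$ are invertible, and that $T_\rho:\mathcal A\to\mathcal B$ is a unital Schwarz map. Then $T$ is reversible for $\mathcal S$ if and only if, for every $\sigma\in\mathcal S$, $$T_\sigma=T_\rho|_{\mathrm{supp}\,\sigma\,\mathcal A\,\mathrm{supp}\,\sigma}.$$ -/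

import Mathlib

namespace PetzRecovery

/-- The trace `Tr = Tr_H` on `B(H)`. -/
noncomputable def opTrace {H : Type*} [NormedAddCommGroup H] [InnerProductSpace ℂ H]
    (a : H →L[ℂ] H) : ℂ :=
  LinearMap.trace ℂ H (a : H →ₗ[ℂ] H)

theorem opTrace_star {H : Type*} [NormedAddCommGroup H] [InnerProductSpace ℂ H]
    [FiniteDimensional ℂ H] [CompleteSpace H] (a : H →L[ℂ] H) :
    opTrace (star a) = star (opTrace a) := by
  have b := stdOrthonormalBasis ℂ H
  simp only [opTrace, LinearMap.trace_eq_sum_inner _ b, star_sum]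
  refine Finset.sum_congr rfl fun i _ => ?_
  simp [ContinuousLinearMap.star_eq_adjoint, ContinuousLinearMap.adjoint_inner_right]

theorem opTrace_star_mul_self {H : Type*} [NormedAddCommGroup H] [InnerProductSpace ℂ H]
    [FiniteDimensional ℂ H] [CompleteSpace H] {ι : Type*} [Fintype ι]
    (b : OrthonormalBasis ι ℂ H) (a : H →L[ℂ] H) :
    opTrace (star a * a) = ((∑ i, ‖a (b i)‖ ^ 2 : ℝ) : ℂ) := by
  simp only [opTrace, LinearMap.trace_eq_sum_inner _ b, Complex.ofReal_sum]
  refine Finset.sum_congr rfl fun i _ => ?_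
  simp [ContinuousLinearMap.star_eq_adjoint, ContinuousLinearMap.adjoint_inner_right,
    inner_self_eq_norm_sq_to_K]

/-- The Hilbert-Schmidt inner product `⟨a, b⟩ = Tr a* b` on a *-subalgebra `𝒜 ⊆ B(H)`. -/
noncomputable abbrev hsCore {H : Type*} [NormedAddCommGroup H] [InnerProductSpace ℂ H]
    [FiniteDimensional ℂ H] [CompleteSpace H] (𝒜 : StarSubalgebra ℂ (H →L[ℂ] H)) :
    InnerProductSpace.Core ℂ 𝒜 where
  inner a b := opTrace (star (a : H →L[ℂ] H) * (b : H →L[ℂ] H))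
  conj_inner_symm a b := by
    rw [starRingEnd_apply, ← opTrace_star]
    simp
  re_inner_nonneg a := by
    rw [opTrace_star_mul_self (stdOrthonormalBasis ℂ H)]
    simp only [RCLike.re_eq_complex_re, Complex.ofReal_re]
    positivity
  add_left a b c := by simp [opTrace, add_mul]
  smul_left a b r := by simp [opTrace]
  definite a h := by
    have b := stdOrthonormalBasis ℂ H
    rw [opTrace_star_mul_self b, Complex.ofReal_eq_zero,
      Finset.sum_eq_zero_iff_of_nonneg (fun i _ => by positivity)] at h
    apply Subtype.ext
    apply ContinuousLinearMap.coe_injective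
    refine b.toBasis.ext fun i => ?_
    simpa using h i (Finset.mem_univ i)

/-- The adjoint of a linear map between finite dimensional spaces with given inner products. -/
noncomputable def coreAdjoint {V W : Type*} [AddCommGroup V] [Module ℂ V] [FiniteDimensional ℂ V]
    [AddCommGroup W] [Module ℂ W] [FiniteDimensional ℂ W]
    (cV : InnerProductSpace.Core ℂ V) (cW : InnerProductSpace.Core ℂ W)
    (T : V →ₗ[ℂ] W) : W →ₗ[ℂ] V :=
  letI : NormedAddCommGroup V := cV.toNormedAddCommGroup
  letI : InnerProductSpace ℂ V := InnerProductSpace.ofCore cV.toCore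
  letI : NormedAddCommGroup W := cW.toNormedAddCommGroup
  letI : InnerProductSpace ℂ W := InnerProductSpace.ofCore cW.toCore
  LinearMap.adjoint T

theorem coreAdjoint_spec {V W : Type*} [AddCommGroup V] [Module ℂ V] [FiniteDimensional ℂ V]
    [AddCommGroup W] [Module ℂ W] [FiniteDimensional ℂ W]
    (cV : InnerProductSpace.Core ℂ V) (cW : InnerProductSpace.Core ℂ W)
    (T : V →ₗ[ℂ] W) (w : W) (v : V) :
    cV.inner (coreAdjoint cV cW T w) v = cW.inner w (T v) :=
  letI : NormedAddCommGroup V := cV.toNormedAddCommGroup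
  letI : InnerProductSpace ℂ V := InnerProductSpace.ofCore cV.toCore
  letI : NormedAddCommGroup W := cW.toNormedAddCommGroup
  letI : InnerProductSpace ℂ W := InnerProductSpace.ofCore cW.toCore
  LinearMap.adjoint_inner_left T v w

instance instFiniteDimensionalCoe {H : Type*} [NormedAddCommGroup H] [InnerProductSpace ℂ H]
    [FiniteDimensional ℂ H] [CompleteSpace H] (𝒜 : StarSubalgebra ℂ (H →L[ℂ] H)) :
    FiniteDimensional ℂ 𝒜 :=
  inferInstanceAs (FiniteDimensional ℂ (Subalgebra.toSubmodule 𝒜.toSubalgebra))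

/-- The adjoint `T* : ℬ → 𝒜` of a linear map `T : 𝒜 → ℬ` with respect to the Hilbert-Schmidt
inner products. -/
noncomputable def hsAdjoint {H K : Type*}
    [NormedAddCommGroup H] [InnerProductSpace ℂ H] [FiniteDimensional ℂ H] [CompleteSpace H]
    [NormedAddCommGroup K] [InnerProductSpace ℂ K] [FiniteDimensional ℂ K] [CompleteSpace K]
    {𝒜 : StarSubalgebra ℂ (H →L[ℂ] H)} {ℬ : StarSubalgebra ℂ (K →L[ℂ] K)}
    (T : 𝒜 →ₗ[ℂ] ℬ) : ℬ →ₗ[ℂ] 𝒜 :=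
  coreAdjoint (hsCore 𝒜) (hsCore ℬ) T

theorem hsAdjoint_spec {H K : Type*}
    [NormedAddCommGroup H] [InnerProductSpace ℂ H] [FiniteDimensional ℂ H] [CompleteSpace H]
    [NormedAddCommGroup K] [InnerProductSpace ℂ K] [FiniteDimensional ℂ K] [CompleteSpace K]
    {𝒜 : StarSubalgebra ℂ (H →L[ℂ] H)} {ℬ : StarSubalgebra ℂ (K →L[ℂ] K)}
    (T : 𝒜 →ₗ[ℂ] ℬ) (b : ℬ) (a : 𝒜) :
    opTrace (star (hsAdjoint T b : H →L[ℂ] H) * (a : H →L[ℂ] H)) =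
      opTrace (star (b : K →L[ℂ] K) * (T a : K →L[ℂ] K)) :=
  coreAdjoint_spec (hsCore 𝒜) (hsCore ℬ) T b a

/-- `Φ` is unital and satisfies the Schwarz inequality `Φ(a)* Φ(a) ≤ Φ(a* a)`, in the
operator order. -/
def IsUnitalSchwarz {H K : Type*}
    [NormedAddCommGroup H] [InnerProductSpace ℂ H] [CompleteSpace H]
    [NormedAddCommGroup K] [InnerProductSpace ℂ K] [CompleteSpace K]
    {𝒜 : StarSubalgebra ℂ (H →L[ℂ] H)} {ℬ : StarSubalgebra ℂ (K →L[ℂ] K)}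
    (Φ : 𝒜 →ₗ[ℂ] ℬ) : Prop :=
  Φ 1 = 1 ∧
    ∀ a : 𝒜, ((star (Φ a) * Φ a : ℬ) : K →L[ℂ] K) ≤ (Φ (star a * a) : K →L[ℂ] K)

/-- The set `𝒮(𝒜)` of density operators in `𝒜`. -/
def densities {H : Type*} [NormedAddCommGroup H] [InnerProductSpace ℂ H] [CompleteSpace H]
    (𝒜 : StarSubalgebra ℂ (H →L[ℂ] H)) : Set 𝒜 :=
  {σ | 0 ≤ (σ : H →L[ℂ] H) ∧ opTrace (σ : H →L[ℂ] H) = 1}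

/-- The support projection of a positive operator: the orthogonal projection onto `(ker a)ᗮ`,
that is, the smallest projection `p` with `a p = a`. -/
noncomputable def supp {H : Type*} [NormedAddCommGroup H] [InnerProductSpace ℂ H]
    [FiniteDimensional ℂ H] (a : H →L[ℂ] H) : H →L[ℂ] H :=
  (LinearMap.ker (a : H →ₗ[ℂ] H))ᗮ.starProjection

/-- The corner `p 𝒜 p`, for a projection `p ∈ 𝒜`. -/
def corner {H : Type*} [NormedAddCommGroup H] [InnerProductSpace ℂ H] [CompleteSpace H]
    (𝒜 : StarSubalgebra ℂ (H →L[ℂ] H)) (p : H →L[ℂ] H) : Set 𝒜 :=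
  {a | ∃ b : 𝒜, (a : H →L[ℂ] H) = p * (b : H →L[ℂ] H) * p}

/-- `a^{-1/2}` for positive `a`, with the inverse taken on the support of `a`: the function is
`x ↦ x^{-1/2}` for `x > 0` and `0 ↦ 0`. -/
noncomputable def invSqrt {H : Type*} [NormedAddCommGroup H] [InnerProductSpace ℂ H]
    [CompleteSpace H] (a : H →L[ℂ] H) : H →L[ℂ] H :=
  cfc (fun x : ℝ => (√x)⁻¹) a

theorem isClosed_coe {H : Type*} [NormedAddCommGroup H] [InnerProductSpace ℂ H]
    [FiniteDimensional ℂ H] [CompleteSpace H] (𝒜 : StarSubalgebra ℂ (H →L[ℂ] H)) :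
    IsClosed (𝒜 : Set (H →L[ℂ] H)) :=
  (Subalgebra.toSubmodule 𝒜.toSubalgebra).closed_of_finiteDimensional

theorem sqrt_mem {H : Type*} [NormedAddCommGroup H] [InnerProductSpace ℂ H]
    [FiniteDimensional ℂ H] [CompleteSpace H] {𝒜 : StarSubalgebra ℂ (H →L[ℂ] H)}
    {a : H →L[ℂ] H} (ha : a ∈ 𝒜) : CFC.sqrt a ∈ 𝒜 := by
  by_cases h : 0 ≤ a
  · have : IsClosed (𝒜 : Set (H →L[ℂ] H)) := isClosed_coe 𝒜
    rw [CFC.sqrt_eq_real_sqrt a]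
    exact cfcₙ_mem _ ha
  · rw [CFC.sqrt_of_not_nonneg h]
    exact zero_mem 𝒜

theorem invSqrt_mem {H : Type*} [NormedAddCommGroup H] [InnerProductSpace ℂ H]
    [FiniteDimensional ℂ H] [CompleteSpace H] {𝒜 : StarSubalgebra ℂ (H →L[ℂ] H)}
    {a : H →L[ℂ] H} (ha : a ∈ 𝒜) : invSqrt a ∈ 𝒜 := by
  have : IsClosed (𝒜 : Set (H →L[ℂ] H)) := isClosed_coe 𝒜
  exact cfc_mem _ ha

/-- `σ^{1/2}` as an element of `𝒜`. -/
noncomputable def sqrtIn {H : Type*} [NormedAddCommGroup H] [InnerProductSpace ℂ H]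
    [FiniteDimensional ℂ H] [CompleteSpace H] {𝒜 : StarSubalgebra ℂ (H →L[ℂ] H)}
    (σ : 𝒜) : 𝒜 :=
  ⟨CFC.sqrt (σ : H →L[ℂ] H), sqrt_mem σ.2⟩

/-- `σ^{-1/2}` (inverse on the support) as an element of `𝒜`. -/
noncomputable def invSqrtIn {H : Type*} [NormedAddCommGroup H] [InnerProductSpace ℂ H]
    [FiniteDimensional ℂ H] [CompleteSpace H] {𝒜 : StarSubalgebra ℂ (H →L[ℂ] H)}
    (σ : 𝒜) : 𝒜 :=
  ⟨invSqrt (σ : H →L[ℂ] H), invSqrt_mem σ.2⟩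

/-- The formula `b ↦ T(σ)^{-1/2} T(σ^{1/2} b σ^{1/2}) T(σ)^{-1/2}`, on all of `𝒜`. The map
`T_σ : p 𝒜 p → p₀ ℬ p₀`, with `p = supp σ` and `p₀ = supp T(σ)`, is its restriction to the corner
`p 𝒜 p`; for invertible `σ` one has `p 𝒜 p = 𝒜`, so it is `T_σ` itself. -/
noncomputable def petz {H K : Type*}
    [NormedAddCommGroup H] [InnerProductSpace ℂ H] [FiniteDimensional ℂ H] [CompleteSpace H]
    [NormedAddCommGroup K] [InnerProductSpace ℂ K] [FiniteDimensional ℂ K] [CompleteSpace K]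
    {𝒜 : StarSubalgebra ℂ (H →L[ℂ] H)} {ℬ : StarSubalgebra ℂ (K →L[ℂ] K)}
    (T : 𝒜 →ₗ[ℂ] ℬ) (σ : 𝒜) : 𝒜 →ₗ[ℂ] ℬ where
  toFun b := invSqrtIn (T σ) * T (sqrtIn σ * b * sqrtIn σ) * invSqrtIn (T σ)
  map_add' a b := by simp only [mul_add, add_mul, map_add]
  map_smul' c a := by
    simp only [mul_smul_comm, smul_mul_assoc, map_smul, RingHom.id_apply]

/-- `T` is reversible for `𝒮`: some `S : ℬ → 𝒜` whose adjoint is a unital Schwarz map satisfies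
`S (T σ) = σ` for all `σ ∈ 𝒮`. -/
def IsReversible {H K : Type*}
    [NormedAddCommGroup H] [InnerProductSpace ℂ H] [FiniteDimensional ℂ H] [CompleteSpace H]
    [NormedAddCommGroup K] [InnerProductSpace ℂ K] [FiniteDimensional ℂ K] [CompleteSpace K]
    {𝒜 : StarSubalgebra ℂ (H →L[ℂ] H)} {ℬ : StarSubalgebra ℂ (K →L[ℂ] K)}
    (T : 𝒜 →ₗ[ℂ] ℬ) (𝒮 : Set 𝒜) : Prop :=
  ∃ S : ℬ →ₗ[ℂ] 𝒜, IsUnitalSchwarz (hsAdjoint S) ∧ ∀ σ ∈ 𝒮, S (T σ) = σ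

end PetzRecovery

/-! Write `α = T*`, `β = T_ρ`, `r = ρ^{1/2}`, `r' = T(ρ)^{1/2}`, with inverses `s`, `s'`. The maps
`α` and `β` are adjoint to each other for the KMS inner products `τ(r a* r b)` and `τ(r' a* r' b)`,
so `α ∘ β` is a unital Schwarz map symmetric for the first of them.

If `S` recovers `σ`, then `δ(b) = s S(r' b r') s` sends `β d` back to `d = s σ s`. Both `α ∘ β` and
`S* ∘ δ` are symmetric, positive and unital, hence bounded above by the identity as quadratic forms;
the equality case gives `α (β d) = d` (`IsKMSDual.fixed_of_reversed`). The fixed points of `α ∘ β`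
form a *-algebra on which `β` is multiplicative (`IsKMSDual.map_star_mul_self`), stable under `x ↦ s
x r` (`IsKMSDual.modular`). Hence they are stable under `x ↦ ρ⁻¹ x σ`, and by functional calculus
they contain `ρ^{-1/2} σ^{1/2}` and `supp σ`; `β` maps these to their analogues for `T(ρ)`, `T(σ)`
(`IsKMSDual.cocycle_and_support`). Multiplicativity then yields `T(σ^{1/2} b σ^{1/2}) = T(σ)^{1/2}
β(b) T(σ)^{1/2}`, which is the asserted equality.

Conversely, the recovery map is `S = (T_ρ)*`: the equality on the corner forces `T_ρ` to send `supp
σ` to `supp T(σ)`, so `supp σ` is in its multiplicative domain, and a trace computation gives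
`S(T(σ)) = σ` (`reversed_of_petz_eq`). -/

namespace PetzRecovery
-- Spectral lemmas on finite dimensional inner product spaces.
section
open scoped ComplexOrder

/-- A symmetric operator on a finite dimensional complex inner product space all of whose real
eigenvalues are at most one is bounded by the identity, and equality in the quadratic form forces
a fixed point. -/
theorem symmetric_re_inner_le {V : Type*} [NormedAddCommGroup V] [InnerProductSpace ℂ V]
    [FiniteDimensional ℂ V] {P : V →ₗ[ℂ] V} (hP : P.IsSymmetric)
    (h : ∀ (c : ℝ) (v : V), v ≠ 0 → P v = (c : ℂ) • v → c ≤ 1) (v : V) :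
    RCLike.re (inner ℂ v (P v)) ≤ RCLike.re (inner ℂ v v) ∧
      (RCLike.re (inner ℂ v (P v)) = RCLike.re (inner ℂ v v) → P v = v) := by
  classical
  set b := hP.eigenvectorBasis rfl
  set e := hP.eigenvalues rfl
  have hb : ∀ i, P (b i) = (e i : ℂ) • b i := fun i => hP.apply_eigenvectorBasis rfl i
  have he : ∀ i, e i ≤ 1 := fun i => h _ (b i) (b.orthonormal.ne_zero i) (hb i)
  have hc : ∀ i, inner ℂ (b i) (P v) = (e i : ℂ) * inner ℂ (b i) v := fun i => by
    rw [← hP, hb, inner_smul_left]; simp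
  have h1 : RCLike.re (inner ℂ v v) = ∑ i, ‖inner ℂ (b i) v‖ ^ 2 := by
    rw [b.sum_sq_norm_inner_right, inner_self_eq_norm_sq]
  have h2 : RCLike.re (inner ℂ v (P v)) = ∑ i, e i * ‖inner ℂ (b i) v‖ ^ 2 := by
    rw [← b.sum_inner_mul_inner, map_sum]
    refine Finset.sum_congr rfl fun i _ => ?_
    rw [hc, ← inner_conj_symm v (b i), mul_left_comm, ← Complex.normSq_eq_conj_mul_self,
      Complex.normSq_eq_norm_sq, ← Complex.ofReal_mul]
    exact Complex.ofReal_re _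
  have hle : ∀ i ∈ Finset.univ, e i * ‖inner ℂ (b i) v‖ ^ 2 ≤ ‖inner ℂ (b i) v‖ ^ 2 :=
    fun i _ => mul_le_of_le_one_left (by positivity) (he i)
  rw [h1, h2]
  refine ⟨Finset.sum_le_sum hle, fun heq => ?_⟩
  rw [Finset.sum_eq_sum_iff_of_le hle] at heq
  refine InnerProductSpace.ext_inner_left_basis b.toBasis fun i => ?_
  rw [OrthonormalBasis.coe_toBasis, hc]
  rcases eq_or_ne (inner ℂ (b i) v) 0 with h0 | h0
  · rw [h0, mul_zero]
  · have := heq i (Finset.mem_univ i)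
    rw [mul_eq_right₀ (by positivity)] at this
    rw [this]; simp

/-- If `β` intertwines a symmetric operator `L` with `L'` on an `L`-invariant subspace, then it
also intertwines functions of these operators. -/
theorem intertwines_function {V W : Type*} [NormedAddCommGroup V] [InnerProductSpace ℂ V]
    [FiniteDimensional ℂ V] [AddCommGroup W] [Module ℂ W] {L : V →ₗ[ℂ] V} (hL : L.IsSymmetric)
    {L' : W →ₗ[ℂ] W} {β : V →ₗ[ℂ] W} {D : Submodule ℂ V} (hD : ∀ x ∈ D, L x ∈ D)
    (hβ : ∀ x ∈ D, β (L x) = L' (β x)) {F : V →ₗ[ℂ] V} {G : W →ₗ[ℂ] W} (f : ℂ → ℂ)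
    (hF : ∀ (c : ℂ) (x : V), L x = c • x → F x = f c • x)
    (hG : ∀ (c : ℂ) (y : W), L' y = c • y → G y = f c • y) {x : V} (hx : x ∈ D) :
    F x ∈ D ∧ β (F x) = G (β x) := by
  have hR := hL.restrict_invariant hD
  set b := hR.eigenvectorBasis rfl
  -- `β` sends an eigenvector of `L` in `D` to zero or to an eigenvector of `L'` with the same
  -- eigenvalue. Only `L` has to be diagonalizable.
  have hb : ∀ i, F (b i) ∈ D ∧ β (F (b i)) = G (β (b i)) := fun i => by
    have h1 : L (b i) = (hR.eigenvalues rfl i : ℂ) • (b i : V) :=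
      congrArg Subtype.val (hR.apply_eigenvectorBasis rfl i)
    have h2 : L' (β (b i)) = (hR.eigenvalues rfl i : ℂ) • β (b i) := by
      rw [← hβ _ (b i).2, h1, map_smul]
    rw [hF _ _ h1, hG _ _ h2, map_smul]
    exact ⟨D.smul_mem _ (b i).2, rfl⟩
  have hsum : x = ∑ i, b.repr ⟨x, hx⟩ i • (b i : V) := by
    have := congrArg D.subtype (b.sum_repr ⟨x, hx⟩)
    rw [map_sum] at this
    exact this.symm
  rw [hsum]
  simp only [map_sum, map_smul, (hb _).2, and_true]
  exact D.sum_mem fun i _ => D.smul_mem _ (hb i).1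

/-- A positive symmetric operator acts on the eigenvectors of its square by the square root of the
eigenvalue. -/
theorem apply_eq_sqrt_smul {V : Type*} [NormedAddCommGroup V] [InnerProductSpace ℂ V]
    {M : V →ₗ[ℂ] V} (hM : M.IsPositive) {c : ℂ} {x : V}
    (hx : M (M x) = c • x) : M x = (√c.re : ℂ) • x := by
  rcases eq_or_ne x 0 with rfl | h0
  · simp
  have h1 : inner ℂ (M x) (M x) = c * inner ℂ x x := by
    rw [hM.isSymmetric, hx, inner_smul_right]
  have hn : 0 < ‖x‖ := norm_pos_iff.2 h0
  have hc : c = ((‖M x‖ ^ 2 / ‖x‖ ^ 2 : ℝ) : ℂ) := by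
    rw [inner_self_eq_norm_sq_to_K, inner_self_eq_norm_sq_to_K] at h1
    push_cast
    rw [eq_div_iff (by exact_mod_cast (pow_pos hn 2).ne')]
    exact h1.symm
  have hm : ((√c.re : ℂ)) * (√c.re : ℂ) = c := by
    conv_rhs => rw [hc]
    rw [← Complex.ofReal_mul, Real.mul_self_sqrt] <;> rw [hc, Complex.ofReal_re]
    positivity
  set m := √c.re with hmdef
  have hm0 : 0 ≤ m := Real.sqrt_nonneg _
  set y := M x - (m : ℂ) • x with hy
  -- `M² - m² = (M + m)(M - m)`, so `y` would be an eigenvector for `-m`, which positivity excludes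
  -- when `m > 0`.
  have hMy : M y = -((m : ℂ) • y) := by
    rw [hy, map_sub, map_smul, hx, ← hm]; module
  rcases hm0.eq_or_lt with h | h
  · rw [← h] at hm ⊢
    rw [← hm] at h1
    simpa using h1
  · have h2 := hM.re_inner_nonneg_right y
    rw [hMy, inner_neg_right, inner_smul_right, inner_self_eq_norm_sq_to_K] at h2
    have h3 : 0 ≤ -(m * ‖y‖ ^ 2) := by
      have h4 : RCLike.re (-((m : ℂ) * ((‖y‖ : ℂ) ^ 2))) = -(m * ‖y‖ ^ 2) := by
        simp [← Complex.ofReal_pow, ← Complex.ofReal_mul]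
      rw [← h4]; exact h2
    have h5 : ‖y‖ ^ 2 ≤ 0 := by nlinarith
    have h6 : y = 0 :=
      norm_eq_zero.1 (pow_eq_zero_iff two_ne_zero |>.1 (le_antisymm h5 (by positivity)))
    exact sub_eq_zero.1 h6
end
end PetzRecovery

/-! ### Faithful traces, Schwarz maps and multiplicative domains. -/

namespace PetzRecovery
section
open scoped ComplexOrder ComplexStarModule

theorem norm_le_of_neg_le_of_le {A : Type*} [CStarAlgebra A] [PartialOrder A] [StarOrderedRing A]
    {x : A} (hx : IsSelfAdjoint x) {c : ℝ} (hc : 0 ≤ c) (h1 : -algebraMap ℝ A c ≤ x)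
    (h2 : x ≤ algebraMap ℝ A c) : ‖x‖ ≤ c := by
  cases subsingleton_or_nontrivial A with
  | inl h => simpa [Subsingleton.elim x 0] using hc
  | inr h =>
    rw [← map_neg, algebraMap_le_iff_le_spectrum] at h1
    rw [le_algebraMap_iff_spectrum_le] at h2
    rcases CStarAlgebra.norm_or_neg_norm_mem_spectrum hx with h | h
    · exact h2 _ h
    · linarith [h1 _ h]

/-- A faithful positive tracial functional. -/
structure IsFaithfulTrace {A : Type*} [Ring A] [StarRing A] [Algebra ℂ A] (τ : A →ₗ[ℂ] ℂ) :
    Prop where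
  mul_comm : ∀ a b, τ (a * b) = τ (b * a)
  map_star : ∀ a, τ (star a) = star (τ a)
  nonneg : ∀ a, 0 ≤ τ (star a * a)
  faithful : ∀ a, τ (star a * a) = 0 → a = 0

theorem IsFaithfulTrace.ext {A : Type*} [Ring A] [StarRing A] [Algebra ℂ A] {τ : A →ₗ[ℂ] ℂ}
    (hτ : IsFaithfulTrace τ) {x y : A} (h : ∀ a, τ (a * x) = τ (a * y)) : x = y := by
  refine sub_eq_zero.1 (hτ.faithful _ ?_)
  rw [mul_sub, map_sub, h, sub_self]

theorem IsFaithfulTrace.apply_swap {A : Type*} [Ring A] [StarRing A] [Algebra ℂ A]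
    {τ : A →ₗ[ℂ] ℂ} (hτ : IsFaithfulTrace τ) (r a b : A) :
    τ (r * a * r * b) = τ (r * b * r * a) := by
  rw [mul_assoc, hτ.mul_comm, ← mul_assoc]

section Trace

variable {A : Type*} [CStarAlgebra A] [PartialOrder A] [StarOrderedRing A]

theorem star_sqrt (a : A) : star (CFC.sqrt a) = CFC.sqrt a :=
  (CFC.sqrt_nonneg a).isSelfAdjoint.star_eq

namespace IsFaithfulTrace

variable {τ : A →ₗ[ℂ] ℂ}

theorem apply_mul_eq (hτ : IsFaithfulTrace τ) {a b : A} (ha : 0 ≤ a) (hb : 0 ≤ b) :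
    τ (a * b) = τ (star (CFC.sqrt a * CFC.sqrt b) * (CFC.sqrt a * CFC.sqrt b)) := by
  rw [star_mul, star_sqrt, star_sqrt, hτ.mul_comm (CFC.sqrt b * CFC.sqrt a)]
  rw [show CFC.sqrt a * CFC.sqrt b * (CFC.sqrt b * CFC.sqrt a)
    = CFC.sqrt a * (CFC.sqrt b * CFC.sqrt b) * CFC.sqrt a by simp only [mul_assoc],
    hτ.mul_comm _ (CFC.sqrt a), CFC.sqrt_mul_sqrt_self b, ← mul_assoc, CFC.sqrt_mul_sqrt_self a]

theorem apply_mul_nonneg (hτ : IsFaithfulTrace τ) {a b : A} (ha : 0 ≤ a) (hb : 0 ≤ b) :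
    0 ≤ τ (a * b) := by
  rw [hτ.apply_mul_eq ha hb]
  exact hτ.nonneg _

theorem mul_eq_zero_of_apply (hτ : IsFaithfulTrace τ) {a b : A} (ha : 0 ≤ a) (hb : 0 ≤ b)
    (h : τ (a * b) = 0) : a * b = 0 := by
  rw [hτ.apply_mul_eq ha hb] at h
  calc a * b = CFC.sqrt a * (CFC.sqrt a * CFC.sqrt b) * CFC.sqrt b := by
        rw [← mul_assoc, CFC.sqrt_mul_sqrt_self a, mul_assoc, CFC.sqrt_mul_sqrt_self b]
    _ = 0 := by rw [hτ.faithful _ h, mul_zero, zero_mul]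

/-- Testing against the negative part of `x` gives minus the squared trace norm of that part, so it
vanishes. -/
theorem nonneg_of_apply (hτ : IsFaithfulTrace τ) {x : A} (hx : IsSelfAdjoint x)
    (h : ∀ a, 0 ≤ a → 0 ≤ τ (x * a)) : 0 ≤ x := by
  have h1 := h _ (CFC.negPart_nonneg x)
  have h2 : x * x⁻ = -(star x⁻ * x⁻) := by
    nth_rw 1 [← CFC.posPart_sub_negPart x]
    rw [sub_mul, CFC.posPart_mul_negPart, (CFC.negPart_nonneg x).isSelfAdjoint.star_eq, zero_sub]
  rw [h2, map_neg] at h1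
  have h3 := hτ.faithful _ (le_antisymm (neg_nonneg.1 h1) (hτ.nonneg _))
  rwa [CFC.negPart_eq_zero_iff x] at h3

end IsFaithfulTrace
end Trace

section Schwarz

variable {A B : Type*} [CStarAlgebra A] [PartialOrder A] [StarOrderedRing A]
  [CStarAlgebra B] [PartialOrder B] [StarOrderedRing B]

theorem map_star_of_map_nonneg {Φ : A →ₗ[ℂ] B} (h : ∀ a, 0 ≤ a → 0 ≤ Φ a) (a : A) :
    Φ (star a) = star (Φ a) := by
  have hsa : ∀ x : A, IsSelfAdjoint x → star (Φ x) = Φ x := fun x hx => by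
    rw [← CFC.posPart_sub_negPart x, map_sub, star_sub,
      (h _ (CFC.posPart_nonneg x)).isSelfAdjoint.star_eq,
      (h _ (CFC.negPart_nonneg x)).isSelfAdjoint.star_eq]
  have h1 := hsa _ (ℜ a).2
  have h2 := hsa _ (ℑ a).2
  conv_lhs => rw [← realPart_add_I_smul_imaginaryPart a]
  conv_rhs => rw [← realPart_add_I_smul_imaginaryPart a]
  rw [star_add, star_smul, map_add, map_smul, map_add, map_smul, star_add, star_smul, h1, h2,
    (ℜ a).2.star_eq, (ℑ a).2.star_eq]

/-- A unital linear map satisfying the Schwarz inequality. -/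
structure IsSchwarzMap (Φ : A →ₗ[ℂ] B) : Prop where
  map_one : Φ 1 = 1
  le_map : ∀ a, star (Φ a) * Φ a ≤ Φ (star a * a)

namespace IsSchwarzMap

variable {Φ : A →ₗ[ℂ] B}

theorem map_nonneg (hΦ : IsSchwarzMap Φ) (a : A) (ha : 0 ≤ a) : 0 ≤ Φ a := by
  obtain ⟨x, rfl⟩ := CStarAlgebra.nonneg_iff_eq_star_mul_self.1 ha
  exact (star_mul_self_nonneg _).trans (hΦ.le_map x)

theorem map_star (hΦ : IsSchwarzMap Φ) (a : A) : Φ (star a) = star (Φ a) :=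
  map_star_of_map_nonneg hΦ.map_nonneg a

/-- Apply the Schwarz inequality to `b + t a`. By `h` the `t²` terms cancel, leaving `P + t X ≥ 0`
for every real `t`, which is possible only for `X = 0`. -/
theorem map_mul_add_eq (hΦ : IsSchwarzMap Φ) {a : A} (h : Φ (star a * a) = star (Φ a) * Φ a)
    (b : A) : Φ (star b * a) + star (Φ (star b * a)) =
      star (Φ b) * Φ a + star (star (Φ b) * Φ a) := by
  set X := Φ (star b * a) + star (Φ (star b * a)) - (star (Φ b) * Φ a + star (star (Φ b) * Φ a))
    with hX
  set P := Φ (star b * b) - star (Φ b) * Φ b with hP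
  have hXsa : IsSelfAdjoint X := by
    simp only [hX, IsSelfAdjoint, star_sub, star_add, star_star]; abel
  have hPsa : IsSelfAdjoint P := (sub_nonneg.2 (hΦ.le_map b)).isSelfAdjoint
  have key : ∀ t : ℝ, 0 ≤ P + (t : ℂ) • X := fun t => by
    have := sub_nonneg.2 (hΦ.le_map (b + (t : ℂ) • a))
    convert this using 1
    have e : star (Φ (star b * a)) = Φ (star a * b) := by rw [← hΦ.map_star, star_mul, star_star]
    rw [hP, hX, e]
    simp only [star_add, star_smul, star_mul, star_star, add_mul, mul_add, map_add, map_smul,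
      smul_mul_assoc, mul_smul_comm, h, Complex.star_def, Complex.conj_ofReal]
    module
  have hbound : ∀ t : ℝ, 0 < t → t * ‖X‖ ≤ ‖P‖ := fun t ht => by
    have h1 : ‖(t : ℂ) • X‖ ≤ ‖P‖ := by
      refine norm_le_of_neg_le_of_le ?_ (norm_nonneg _) ?_ ?_
      · rw [IsSelfAdjoint, star_smul, hXsa.star_eq]; simp
      · have h2 := key t
        have h3 := hPsa.le_algebraMap_norm_self
        rw [neg_le_iff_add_nonneg]
        exact h2.trans (by rw [add_comm]; gcongr)
      · have h2 := key (-t)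
        have h3 := hPsa.le_algebraMap_norm_self
        rw [Complex.ofReal_neg, neg_smul, ← sub_eq_add_neg, sub_nonneg] at h2
        exact h2.trans h3
    rwa [norm_smul, Complex.norm_real, Real.norm_of_nonneg ht.le] at h1
  by_contra hne
  have hXpos : 0 < ‖X‖ := norm_pos_iff.2 (sub_ne_zero.2 hne)
  have := hbound ((‖P‖ + 1) / ‖X‖) (by positivity)
  rw [div_mul_cancel₀ _ hXpos.ne'] at this
  linarith

/-- Multiplicative domain: replacing `b` by `i b` recovers the full identity from its real part. -/
theorem map_mul_of_map_star_mul_self (hΦ : IsSchwarzMap Φ) {a : A}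
    (h : Φ (star a * a) = star (Φ a) * Φ a) (b : A) : Φ (b * a) = Φ b * Φ a := by
  have h1 := hΦ.map_mul_add_eq h (star b)
  have h2 := hΦ.map_mul_add_eq h (star (Complex.I • b))
  simp only [star_star] at h1 h2
  simp only [smul_mul_assoc, map_smul, star_smul, hΦ.map_star, star_star] at h2
  have h3 : (2 * Complex.I) • Φ (b * a) = (2 * Complex.I) • (Φ b * Φ a) := by
    simp only [Complex.star_def, Complex.conj_I, hΦ.map_star, star_star, star_mul]
      at h1 h2
    linear_combination (norm := module) Complex.I • h1 + h2
  exact smul_right_injective B (by simp : 2 * Complex.I ≠ 0) h3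

theorem map_mul_of_map_mul_star_self (hΦ : IsSchwarzMap Φ) {a : A}
    (h : Φ (a * star a) = Φ a * star (Φ a)) (b : A) : Φ (a * b) = Φ a * Φ b := by
  have := hΦ.map_mul_of_map_star_mul_self (a := star a)
    (by rw [star_star, h, hΦ.map_star, star_star]) (star b)
  apply star_injective
  rw [← hΦ.map_star, star_mul, this, hΦ.map_star, hΦ.map_star, star_mul]

end IsSchwarzMap

/-- Real eigenvalues of a positive unital map are at most one. -/
theorem eigenvalue_le_one {P : A →ₗ[ℂ] A} (h1 : P 1 = 1) (hP : ∀ a, 0 ≤ a → 0 ≤ P a) {c : ℝ}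
    {v : A} (hv : v ≠ 0) (hc : P v = (c : ℂ) • v) : c ≤ 1 := by
  -- `P` preserves the order interval `[-‖x‖, ‖x‖]`, so it cannot increase the norm of a
  -- self-adjoint `x`. Since `c` is real, either `v + v*` or, if that vanishes, `i v` is a
  -- self-adjoint eigenvector.
  have key : ∀ x : A, IsSelfAdjoint x → P x = (c : ℂ) • x → x ≠ 0 → c ≤ 1 := by
    intro x hx hcx hx0
    by_contra! hlt
    have h1' : P (algebraMap ℝ A ‖x‖) = algebraMap ℝ A ‖x‖ := by
      rw [Algebra.algebraMap_eq_smul_one, ← Complex.coe_smul, map_smul, h1]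
    have hmono : ∀ a b : A, a ≤ b → P a ≤ P b := fun a b hab => by
      rw [← sub_nonneg, ← map_sub]; exact hP _ (sub_nonneg.2 hab)
    have h2 := hmono _ _ hx.le_algebraMap_norm_self
    have h3 := hmono _ _ hx.neg_algebraMap_norm_le_self
    rw [map_neg, h1', hcx] at h3
    rw [h1', hcx] at h2
    have h4 := norm_le_of_neg_le_of_le (by rw [IsSelfAdjoint, star_smul, hx.star_eq]; simp)
      (norm_nonneg _) h3 h2
    rw [norm_smul, Complex.norm_real, Real.norm_of_nonneg (by linarith)] at h4
    nlinarith [norm_pos_iff.2 hx0]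
  have hs : P (star v) = (c : ℂ) • star v := by
    rw [map_star_of_map_nonneg hP, hc, star_smul]; simp
  by_cases h0 : v + star v = 0
  · refine key (Complex.I • v) ?_ ?_ (smul_ne_zero Complex.I_ne_zero hv)
    · rw [IsSelfAdjoint, star_smul, ← neg_eq_iff_add_eq_zero.2 h0]; simp
    · rw [map_smul, hc, smul_comm]
  · refine key _ ?_ ?_ h0
    · rw [IsSelfAdjoint, star_add, star_star, add_comm]
    · rw [map_add, hc, hs, smul_add]

end Schwarz
end
end PetzRecovery

/-! ### The KMS inner product and contractivity of symmetric positive unital maps. -/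

namespace PetzRecovery
section
open scoped ComplexOrder

/-- The inner product `⟨x, y⟩ = τ (j x)* (j y)` defined by a faithful trace `τ` and an injective
linear map `j`. -/
noncomputable abbrev traceCore {V A : Type*} [AddCommGroup V] [Module ℂ V] [Ring A] [StarRing A]
    [Algebra ℂ A] [StarModule ℂ A] {τ : A →ₗ[ℂ] ℂ} (hτ : IsFaithfulTrace τ) (j : V →ₗ[ℂ] A)
    (hj : Function.Injective j) : InnerProductSpace.Core ℂ V where
  inner x y := τ (star (j x) * j y)
  conj_inner_symm x y := by
    rw [starRingEnd_apply, ← hτ.map_star, star_mul, star_star]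
  re_inner_nonneg x := (Complex.nonneg_iff.1 (hτ.nonneg (j x))).1
  add_left x y z := by simp [add_mul]
  smul_left x y c := by simp
  definite x h := hj (by rw [hτ.faithful _ h, map_zero])

/-- The algebra carries its C*-norm already, so the Hilbert space lemmas are restated for an
explicit `InnerProductSpace.Core`, whose norm stays local. -/
theorem core_apply_eq_sqrt_smul {V : Type*} [AddCommGroup V] [Module ℂ V]
    (c : InnerProductSpace.Core ℂ V) {M : V →ₗ[ℂ] V}
    (hM : ∀ x y, c.inner (M x) y = c.inner x (M y))
    (hpos : ∀ x, 0 ≤ (c.inner (M x) x).re) {t : ℂ} {x : V}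
    (hx : M (M x) = t • x) : M x = (√t.re : ℂ) • x :=
  letI : NormedAddCommGroup V := c.toNormedAddCommGroup
  letI : InnerProductSpace ℂ V := InnerProductSpace.ofCore c.toCore
  apply_eq_sqrt_smul (M := M) ⟨hM, hpos⟩ hx

section Core

variable {V : Type*} [AddCommGroup V] [Module ℂ V] [FiniteDimensional ℂ V]
  (c : InnerProductSpace.Core ℂ V)

theorem core_symmetric_re_inner_le {P : V →ₗ[ℂ] V}
    (hP : ∀ x y, c.inner (P x) y = c.inner x (P y))
    (h : ∀ (t : ℝ) (v : V), v ≠ 0 → P v = (t : ℂ) • v → t ≤ 1) (v : V) :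
    (c.inner v (P v)).re ≤ (c.inner v v).re ∧
      ((c.inner v (P v)).re = (c.inner v v).re → P v = v) :=
  letI : NormedAddCommGroup V := c.toNormedAddCommGroup
  letI : InnerProductSpace ℂ V := InnerProductSpace.ofCore c.toCore
  symmetric_re_inner_le (P := P) hP h v

theorem core_intertwines_function {W : Type*} [AddCommGroup W] [Module ℂ W] {L : V →ₗ[ℂ] V}
    (hL : ∀ x y, c.inner (L x) y = c.inner x (L y))
    {L' : W →ₗ[ℂ] W} {β : V →ₗ[ℂ] W} {D : Submodule ℂ V} (hD : ∀ x ∈ D, L x ∈ D)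
    (hβ : ∀ x ∈ D, β (L x) = L' (β x)) {F : V →ₗ[ℂ] V} {G : W →ₗ[ℂ] W} (f : ℂ → ℂ)
    (hF : ∀ (c : ℂ) (x : V), L x = c • x → F x = f c • x)
    (hG : ∀ (c : ℂ) (y : W), L' y = c • y → G y = f c • y) {x : V} (hx : x ∈ D) :
    F x ∈ D ∧ β (F x) = G (β x) :=
  letI : NormedAddCommGroup V := c.toNormedAddCommGroup
  letI : InnerProductSpace ℂ V := InnerProductSpace.ofCore c.toCore
  intertwines_function (L := L) hL hD hβ f hF hG hx

end Core

/-- `r` is positive and invertible with inverse `s`. -/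
structure IsPosInv {A : Type*} [Ring A] [PartialOrder A] (r s : A) : Prop where
  nonneg : 0 ≤ r
  mul_inv : r * s = 1
  inv_mul : s * r = 1

namespace IsPosInv

theorem mul_mul_cancel {A : Type*} [Ring A] [PartialOrder A] {r s : A} (h : IsPosInv r s) (x : A) :
    r * (s * x) = x := by
  rw [← mul_assoc, h.mul_inv, one_mul]

theorem mul_mul_cancel' {A : Type*} [Ring A] [PartialOrder A] {r s : A} (h : IsPosInv r s) (x : A) :
    x * r * s = x := by
  rw [mul_assoc, h.mul_inv, mul_one]

variable {A : Type*} [CStarAlgebra A] [PartialOrder A] [StarOrderedRing A] {r s : A}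

theorem star_left (h : IsPosInv r s) : star r = r := h.nonneg.isSelfAdjoint.star_eq

theorem star_right (h : IsPosInv r s) : star s = s := by
  have h1 : star s * r = 1 := by rw [← h.star_left, ← star_mul, h.mul_inv, star_one]
  calc star s = star s * (r * s) := by rw [h.mul_inv, mul_one]
    _ = s := by rw [← mul_assoc, h1, one_mul]

theorem symm (h : IsPosInv r s) : IsPosInv s r where
  nonneg := by
    have := star_left_conjugate_nonneg h.nonneg s
    rwa [h.star_right, h.inv_mul, one_mul] at this
  mul_inv := h.inv_mul
  inv_mul := h.mul_inv

theorem apply_conj_star_mul {τ : A →ₗ[ℂ] ℂ} (hτ : IsFaithfulTrace τ) (h : IsPosInv r s) (a b : A) :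
    τ (star (CFC.sqrt r * a * CFC.sqrt r) * (CFC.sqrt r * b * CFC.sqrt r)) =
      τ (r * star a * r * b) := by
  have hr := h.nonneg
  rw [star_mul, star_mul, star_sqrt,
    show CFC.sqrt r * (star a * CFC.sqrt r) * (CFC.sqrt r * b * CFC.sqrt r) =
      CFC.sqrt r * (star a * (CFC.sqrt r * CFC.sqrt r) * b * CFC.sqrt r) by simp only [mul_assoc],
    hτ.mul_comm, CFC.sqrt_mul_sqrt_self r,
    show star a * r * b * CFC.sqrt r * CFC.sqrt r = star a * r * b * (CFC.sqrt r * CFC.sqrt r) by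
      simp only [mul_assoc],
    CFC.sqrt_mul_sqrt_self r, hτ.mul_comm]
  simp only [mul_assoc]

theorem eq_zero_of_apply {τ : A →ₗ[ℂ] ℂ} (hτ : IsFaithfulTrace τ) (h : IsPosInv r s) {x : A}
    (hx : 0 ≤ x) (h0 : τ (r * x * r) = 0) : x = 0 := by
  have h1 : 0 ≤ r * r := by
    nth_rw 1 [← h.star_left]; exact star_mul_self_nonneg r
  rw [hτ.mul_comm, ← mul_assoc] at h0
  have h2 := hτ.mul_eq_zero_of_apply h1 hx h0
  calc x = s * (s * (r * r * x)) := by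
        rw [mul_assoc r r, h.symm.mul_mul_cancel, h.symm.mul_mul_cancel]
    _ = 0 := by rw [h2, mul_zero, mul_zero]

/-- A positive unital map which is symmetric for the inner product `τ (r a* r b)` is a contraction
for it. -/
theorem kms_contraction [FiniteDimensional ℂ A] {τ : A →ₗ[ℂ] ℂ} (hτ : IsFaithfulTrace τ)
    (h : IsPosInv r s) {P : A →ₗ[ℂ] A} (h1 : P 1 = 1) (hP : ∀ a, 0 ≤ a → 0 ≤ P a)
    (hsym : ∀ a b, τ (r * P (star a) * r * b) = τ (r * star a * r * P b)) (v : A) :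
    (τ (r * star v * r * P v)).re ≤ (τ (r * star v * r * v)).re ∧
      ((τ (r * star v * r * P v)).re = (τ (r * star v * r * v)).re → P v = v) := by
  have hr := h.nonneg
  -- Pulling the trace inner product back along `a ↦ r^{1/2} a r^{1/2}` gives `τ(r a* r b)`.
  let j : A →ₗ[ℂ] A := LinearMap.mulRight ℂ (CFC.sqrt r) ∘ₗ LinearMap.mulLeft ℂ (CFC.sqrt r)
  have hjapp : ∀ a, j a = CFC.sqrt r * a * CFC.sqrt r := fun a => rfl
  have hj : Function.Injective j := by
    refine (injective_iff_map_eq_zero j).2 fun a ha => ?_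
    rw [hjapp] at ha
    calc a = s * (CFC.sqrt r * (CFC.sqrt r * a * CFC.sqrt r) * CFC.sqrt r) * s := by
          rw [show CFC.sqrt r * (CFC.sqrt r * a * CFC.sqrt r) * CFC.sqrt r =
            (CFC.sqrt r * CFC.sqrt r) * a * (CFC.sqrt r * CFC.sqrt r) by simp only [mul_assoc],
            CFC.sqrt_mul_sqrt_self r, mul_assoc, h.mul_mul_cancel', h.symm.mul_mul_cancel]
      _ = 0 := by rw [ha]; simp
  have hin : ∀ a b, (traceCore hτ j hj).inner a b = τ (r * star a * r * b) :=
    fun a b => h.apply_conj_star_mul hτ a b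
  have := core_symmetric_re_inner_le (traceCore hτ j hj) (P := P)
    (fun x y => by rw [hin, hin, ← map_star_of_map_nonneg hP, hsym])
    (fun t v hv ht => eigenvalue_le_one h1 hP hv ht) v
  rwa [hin, hin] at this

end IsPosInv

end
end PetzRecovery

/-! ### KMS-dual pairs and the fixed points of `α ∘ β`. -/

namespace PetzRecovery
section
open scoped ComplexOrder

variable {A B : Type*} [CStarAlgebra A] [PartialOrder A] [CStarAlgebra B] [PartialOrder B]

/-- Schwarz maps `α` and `β` which are adjoint to each other for the inner products
`τ (r a* r b)`. -/
structure IsKMSDual (τA : A →ₗ[ℂ] ℂ) (τB : B →ₗ[ℂ] ℂ) (r s : A) (r' s' : B) (α : B →ₗ[ℂ] A)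
    (β : A →ₗ[ℂ] B) : Prop where
  traceA : IsFaithfulTrace τA
  traceB : IsFaithfulTrace τB
  posA : IsPosInv r s
  posB : IsPosInv r' s'
  schwarzA : IsSchwarzMap α
  schwarzB : IsSchwarzMap β
  dual : ∀ a b, τA (r * a * r * α b) = τB (r' * β a * r' * b)

namespace IsKMSDual

variable {τA : A →ₗ[ℂ] ℂ} {τB : B →ₗ[ℂ] ℂ} {r s : A} {r' s' : B} {α : B →ₗ[ℂ] A} {β : A →ₗ[ℂ] B}

theorem symm (h : IsKMSDual τA τB r s r' s' α β) : IsKMSDual τB τA r' s' r s β α where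
  traceA := h.traceB
  traceB := h.traceA
  posA := h.posB
  posB := h.posA
  schwarzA := h.schwarzB
  schwarzB := h.schwarzA
  dual b a := by
    have h1 := h.dual a b
    rw [mul_assoc _ r, h.traceA.mul_comm, mul_assoc _ r', h.traceB.mul_comm] at h1
    simpa only [mul_assoc] using h1.symm

theorem trace_map (h : IsKMSDual τA τB r s r' s' α β) (a : A) :
    τA (r * a * r) = τB (r' * β a * r') := by
  simpa [h.schwarzA.map_one] using h.dual a 1

variable [StarOrderedRing A] [StarOrderedRing B]

theorem fixed_star (h : IsKMSDual τA τB r s r' s' α β) {d : A} (hd : α (β d) = d) :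
    α (β (star d)) = star d := by
  rw [h.schwarzB.map_star, h.schwarzA.map_star, hd]

/-- Two Schwarz inequalities give `α(β(d* d)) ≥ α(β(d)* β(d)) ≥ d* d`. The faithful functional `τ(r
· r)` is invariant under `α ∘ β`, so both are equalities; faithfulness on the `B` side then removes
`α`. -/
theorem map_star_mul_self (h : IsKMSDual τA τB r s r' s' α β) {d : A} (hd : α (β d) = d) :
    β (star d * d) = star (β d) * β d := by
  have h1 := sub_nonneg.2 (h.schwarzB.le_map d)
  have h2 := h.schwarzA.map_nonneg _ h1
  have h3 := sub_nonneg.2 (h.schwarzA.le_map (β d))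
  rw [hd] at h3
  have h4 : α (β (star d * d)) - star d * d = 0 := by
    refine h.posA.eq_zero_of_apply h.traceA ?_ ?_
    · simpa using add_nonneg h2 h3
    · rw [mul_sub, sub_mul, map_sub, ← h.symm.trace_map, ← h.trace_map, sub_self]
  have h5 : α (β (star d * d) - star (β d) * β d) = 0 := by
    refine le_antisymm ?_ h2
    rw [← neg_nonneg]
    have : -α (β (star d * d) - star (β d) * β d) = α (star (β d) * β d) - star d * d := by
      rw [map_sub, sub_eq_zero.1 h4]; abel
    rwa [this]
  refine sub_eq_zero.1 (h.posB.eq_zero_of_apply h.traceB h1 ?_)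
  rw [h.symm.trace_map, h5]; simp

theorem map_mul_fixed (h : IsKMSDual τA τB r s r' s' α β) {d : A} (hd : α (β d) = d) (a : A) :
    β (a * d) = β a * β d :=
  h.schwarzB.map_mul_of_map_star_mul_self (h.map_star_mul_self hd) a

theorem map_fixed_mul (h : IsKMSDual τA τB r s r' s' α β) {d : A} (hd : α (β d) = d) (a : A) :
    β (d * a) = β d * β a := by
  refine h.schwarzB.map_mul_of_map_mul_star_self ?_ a
  have := h.map_star_mul_self (h.fixed_star hd)
  rwa [star_star, h.schwarzB.map_star, star_star] at this

theorem fixed_mul (h : IsKMSDual τA τB r s r' s' α β) {d e : A} (hd : α (β d) = d)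
    (he : α (β e) = e) : α (β (d * e)) = d * e := by
  rw [h.map_mul_fixed he, h.symm.map_mul_fixed (by rw [he]), hd, he]

/-- Invariance of the weighted trace at `a d`, with `β(a d) = β(a) β(d)`, is read through `r a d r =
(r a r)(s d r)` as a KMS pairing with `s d r`; varying `a` identifies the two sides. -/
theorem map_modular (h : IsKMSDual τA τB r s r' s' α β) {d : A} (hd : α (β d) = d) :
    α (s' * β d * r') = s * d * r := by
  have key : ∀ a, τA (r * a * r * α (s' * β d * r')) = τA (r * a * r * (s * d * r)) := fun a => by
    have h1 := h.trace_map (a * d)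
    rw [h.map_mul_fixed hd] at h1
    have h2 : r * a * r * (s * d * r) = r * (a * d) * r := by
      simp only [mul_assoc, h.posA.mul_mul_cancel]
    have h3 : r' * β a * r' * (s' * β d * r') = r' * (β a * β d) * r' := by
      simp only [mul_assoc, h.posB.mul_mul_cancel]
    rw [h.dual, h2, h3, h1]
  refine h.traceA.ext fun a => ?_
  have := key (s * a * s)
  rwa [show r * (s * a * s) * r = a by
    rw [mul_assoc s, h.posA.mul_mul_cancel, h.posA.symm.mul_mul_cancel']] at this

theorem modular (h : IsKMSDual τA τB r s r' s' α β) {d : A} (hd : α (β d) = d) :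
    α (β (s * d * r)) = s * d * r ∧ β (s * d * r) = s' * β d * r' := by
  have h1 := h.symm.map_modular (d := β d) (by rw [hd])
  rw [hd] at h1
  exact ⟨by rw [h1, h.map_modular hd], h1⟩

/-- If a positive unital map `δ`, dual to a Schwarz map, satisfies `δ (β d) = d`, then `d` is also
recovered by `α`. -/
theorem fixed_of_reversed [FiniteDimensional ℂ A] [FiniteDimensional ℂ B]
    (h : IsKMSDual τA τB r s r' s' α β) {γ : A →ₗ[ℂ] B} {δ : B →ₗ[ℂ] A} (hγ : IsSchwarzMap γ)
    (hδ1 : δ 1 = 1) (hδ : ∀ b, 0 ≤ b → 0 ≤ δ b)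
    (hdual : ∀ a b, τA (r * a * r * δ b) = τB (r' * γ a * r' * b)) {d : A} (hd : δ (β d) = d) :
    α (β d) = d := by
  have hA := h.posA.kms_contraction h.traceA (P := α ∘ₗ β)
    (by simp [h.schwarzA.map_one, h.schwarzB.map_one])
    (fun a ha => h.schwarzA.map_nonneg _ (h.schwarzB.map_nonneg _ ha))
    (fun a b => by
      simp only [LinearMap.comp_apply]
      rw [h.traceA.apply_swap, h.dual, h.dual, h.traceB.apply_swap])
    d
  have hB := h.posB.kms_contraction h.traceB (P := γ ∘ₗ δ)
    (by simp [hγ.map_one, hδ1])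
    (fun a ha => hγ.map_nonneg _ (hδ _ ha))
    (fun a b => by
      simp only [LinearMap.comp_apply]
      rw [h.traceB.apply_swap _ (star a), ← hdual, ← hdual, h.traceA.apply_swap])
    (β d)
  simp only [LinearMap.comp_apply] at hA hB
  -- In KMS inner products, `⟨d, d⟩ = ⟨β d, γ δ β d⟩ ≤ ⟨β d, β d⟩ = ⟨d, α β d⟩ ≤ ⟨d, d⟩`. Only
  -- positivity and unitality of `δ` enter, so no Schwarz inequality for it is needed.
  refine hA.2 (le_antisymm hA.1 ?_)
  have h1 : τB (r' * star (β d) * r' * γ (δ (β d))) = τA (r * star d * r * d) := by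
    rw [h.traceB.apply_swap, ← hdual, map_star_of_map_nonneg hδ, hd, h.traceA.apply_swap]
  have h2 := h.dual (star d) (β d)
  rw [h.schwarzB.map_star] at h2
  rw [h2, ← h1]
  exact hB.1

end IsKMSDual
end
end PetzRecovery

/-! ### The cocycle `ρ^{-1/2} σ^{1/2}` and the support of `σ` as fixed points. -/

namespace PetzRecovery
section
open scoped ComplexOrder

namespace IsKMSDual

/-- The fixed points of `α ∘ β`. -/
def fixedPoints {A B : Type*} [Ring A] [Algebra ℂ A] [Ring B] [Algebra ℂ B] (α : B →ₗ[ℂ] A)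
    (β : A →ₗ[ℂ] B) : Submodule ℂ A :=
  LinearMap.eqLocus (α ∘ₗ β) LinearMap.id

theorem mem_fixedPoints {A B : Type*} [Ring A] [Algebra ℂ A] [Ring B] [Algebra ℂ B] {α : B →ₗ[ℂ] A}
    {β : A →ₗ[ℂ] B} {d : A} :
    d ∈ fixedPoints α β ↔ α (β d) = d := Iff.rfl

section MulLeftRight

variable {A : Type*} [Ring A] [Algebra ℂ A]

/-- Left and right multiplication, `x ↦ a x b`. -/
def mulLeftRight (a b : A) : A →ₗ[ℂ] A :=
  LinearMap.mulRight ℂ b ∘ₗ LinearMap.mulLeft ℂ a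

theorem mulLeftRight_apply (a b x : A) : mulLeftRight a b x = a * x * b := rfl

theorem mulLeftRight_mul_self (s t x : A) :
    mulLeftRight (s * s) (t * t) x = mulLeftRight s t (mulLeftRight s t x) := by
  simp only [mulLeftRight_apply, mul_assoc]

theorem mulLeftRight_symmetric [StarRing A] [StarModule ℂ A] {τ : A →ₗ[ℂ] ℂ}
    (hτ : IsFaithfulTrace τ) {a b : A} (ha : star a = a) (hb : star b = b) (x y : A) :
    (traceCore hτ LinearMap.id Function.injective_id).inner (mulLeftRight a b x) y =
      (traceCore hτ LinearMap.id Function.injective_id).inner x (mulLeftRight a b y) := by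
  change τ (star (a * x * b) * y) = τ (star x * (a * y * b))
  rw [star_mul, star_mul, ha, hb, mul_assoc, hτ.mul_comm b]
  simp only [mul_assoc]

/-- Right multiplication by the support `q` is the indicator function of nonzero eigenvalues applied
to `x ↦ ρ⁻¹ x σ`. -/
theorem mulLeftRight_one_eq_ite_smul [PartialOrder A] {r s : A} (h : IsPosInv r s) {σ q k : A}
    (hk : σ * k = q) (hq : σ * q = σ) {c : ℂ} {x : A} (hx : mulLeftRight (s * s) σ x = c • x) :
    mulLeftRight 1 q x = (if c = 0 then 0 else 1 : ℂ) • x := by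
  rw [mulLeftRight_apply] at hx
  rw [mulLeftRight_apply, one_mul]
  split_ifs with hc
  · have h1 : x * σ = 0 := by
      calc x * σ = r * (r * (s * s * x * σ)) := by
            simp only [mul_assoc, h.mul_mul_cancel]
        _ = 0 := by rw [hx, hc]; simp
    rw [← hk, ← mul_assoc, h1]; simp
  · have h1 : c • (x * q) = c • x := by
      rw [← smul_mul_assoc, ← hx, mul_assoc, hq]
    rw [one_smul]
    exact smul_right_injective A hc h1

end MulLeftRight

variable {A B : Type*} [CStarAlgebra A] [PartialOrder A] [StarOrderedRing A]
  [CStarAlgebra B] [PartialOrder B] [StarOrderedRing B]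
  {τA : A →ₗ[ℂ] ℂ} {τB : B →ₗ[ℂ] ℂ} {r s : A} {r' s' : B} {α : B →ₗ[ℂ] A} {β : A →ₗ[ℂ] B}

theorem mulLeftRight_nonneg {τ : A →ₗ[ℂ] ℂ} (hτ : IsFaithfulTrace τ) {a b : A}
    (ha : 0 ≤ a) (hb : 0 ≤ b) (x : A) :
    0 ≤ ((traceCore hτ LinearMap.id Function.injective_id).inner (mulLeftRight a b x) x).re := by
  change 0 ≤ (τ (star (a * x * b) * x)).re
  have h : τ (star (a * x * b) * x) =
      τ (star (CFC.sqrt a * x * CFC.sqrt b) * (CFC.sqrt a * x * CFC.sqrt b)) := by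
    have e : star (a * x * b) * x = CFC.sqrt b * (CFC.sqrt b * star x * a * x) := by
      rw [star_mul, star_mul, ha.isSelfAdjoint.star_eq, hb.isSelfAdjoint.star_eq]
      nth_rw 1 [← CFC.sqrt_mul_sqrt_self b]
      simp only [mul_assoc]
    rw [e, hτ.mul_comm, star_mul, star_mul, star_sqrt, star_sqrt]
    nth_rw 1 [← CFC.sqrt_mul_sqrt_self a]
    simp only [mul_assoc]
  rw [h]
  exact (Complex.nonneg_iff.1 (hτ.nonneg _)).1

theorem mulLeftRight_apply_eq_sqrt_smul {τ : A →ₗ[ℂ] ℂ} (hτ : IsFaithfulTrace τ) {a b : A}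
    (ha : 0 ≤ a) (hb : 0 ≤ b) {c : ℂ} {x : A} (h : mulLeftRight (a * a) (b * b) x = c • x) :
    mulLeftRight a b x = (√c.re : ℂ) • x := by
  rw [mulLeftRight_mul_self] at h
  exact core_apply_eq_sqrt_smul _
    (mulLeftRight_symmetric hτ ha.isSelfAdjoint.star_eq hb.isSelfAdjoint.star_eq)
    (mulLeftRight_nonneg hτ ha hb) h

/-- With `Δ x = s x r` and `d = s σ s`, one has `ρ⁻¹ x σ = Δ²(x) Δ(d)`, a product of fixed points.
-/
theorem fixed_left_right (h : IsKMSDual τA τB r s r' s' α β) {σ : A} {σ' : B}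
    (hd : α (β (s * σ * s)) = s * σ * s) (hβ : β (s * σ * s) = s' * σ' * s') {x : A}
    (hx : α (β x) = x) :
    α (β (s * s * x * σ)) = s * s * x * σ ∧ β (s * s * x * σ) = s' * s' * β x * σ' := by
  have e : s * s * x * σ = s * (s * x * r) * r * (s * (s * σ * s) * r) := by
    simp only [mul_assoc, h.posA.mul_mul_cancel, h.posA.inv_mul, mul_one]
  obtain ⟨f1, b1⟩ := h.modular hx
  obtain ⟨f2, b2⟩ := h.modular f1
  obtain ⟨f3, b3⟩ := h.modular hd
  rw [e]
  refine ⟨h.fixed_mul f2 f3, ?_⟩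
  rw [h.map_mul_fixed f3, b2, b1, b3, hβ]
  simp only [mul_assoc, h.posB.mul_mul_cancel, h.posB.inv_mul, mul_one]

/-- The cocycle `ρ^{-1/2} σ^{1/2}` and the support of `σ` are fixed points, and `β` maps them to the
corresponding elements of the target. -/
theorem cocycle_and_support [FiniteDimensional ℂ A] (h : IsKMSDual τA τB r s r' s' α β)
    {t q k : A} {t' q' k' : B} (ht : 0 ≤ t) (ht' : 0 ≤ t')
    (hk : t * t * k = q) (hq : t * t * q = t * t) (hk' : t' * t' * k' = q')
    (hq' : t' * t' * q' = t' * t')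
    (hd : α (β (s * (t * t) * s)) = s * (t * t) * s)
    (hβ : β (s * (t * t) * s) = s' * (t' * t') * s') :
    (α (β (s * t)) = s * t ∧ β (s * t) = s' * t') ∧ (α (β q) = q ∧ β q = q') := by
  have hs := h.posA.symm
  have hs' := h.posB.symm
  have hss : star (s * s) = s * s := by rw [star_mul, hs.star_left]
  have htt : star (t * t) = t * t := by rw [star_mul, ht.isSelfAdjoint.star_eq]
  have hone : (1 : A) ∈ fixedPoints α β := by
    rw [mem_fixedPoints, h.schwarzB.map_one, h.schwarzA.map_one]
  -- Functions of `x ↦ ρ⁻¹ x σ` are applied to the fixed point `1`: the square root yields `s t`,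
  -- the indicator of nonzero eigenvalues yields `q`.
  have key := fun {F : A →ₗ[ℂ] A} {G : B →ₗ[ℂ] B} (f : ℂ → ℂ) hF hG =>
    core_intertwines_function (traceCore h.traceA LinearMap.id Function.injective_id)
      (L := mulLeftRight (s * s) (t * t)) (L' := mulLeftRight (s' * s') (t' * t')) (β := β)
      (D := fixedPoints α β) (mulLeftRight_symmetric h.traceA hss htt)
      (fun x hx => (h.fixed_left_right hd hβ hx).1) (fun x hx => (h.fixed_left_right hd hβ hx).2)
      (F := F) (G := G) f hF hG hone
  have h1 := key (F := mulLeftRight s t) (G := mulLeftRight s' t') (fun c => (√c.re : ℂ))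
    (fun c x hx => mulLeftRight_apply_eq_sqrt_smul h.traceA hs.nonneg ht hx)
    (fun c x hx => mulLeftRight_apply_eq_sqrt_smul h.traceB hs'.nonneg ht' hx)
  have h2 := key (F := mulLeftRight 1 q) (G := mulLeftRight 1 q')
    (fun c => if c = 0 then 0 else 1)
    (fun c x hx => mulLeftRight_one_eq_ite_smul h.posA hk hq hx)
    (fun c x hx => mulLeftRight_one_eq_ite_smul h.posB hk' hq' hx)
  simp only [mulLeftRight_apply, mul_one, one_mul, h.schwarzB.map_one, mem_fixedPoints] at h1 h2
  exact ⟨h1, h2⟩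

end IsKMSDual
end
end PetzRecovery

/-! ### Both implications for abstract C*-algebras with faithful traces. -/

namespace PetzRecovery
section
open scoped ComplexOrder

/-- `t` is positive with support projection `q`, and `k` is its inverse on the support. -/
structure IsSupportInv {A : Type*} [Ring A] [StarRing A] [PartialOrder A] (t k q : A) : Prop where
  nonneg : 0 ≤ t
  star_eq : star q = q
  mul_inv : t * k = q
  inv_mul : k * t = q
  mul_supp : t * q = t

namespace IsSupportInv

variable {A : Type*} [Ring A] [StarRing A] [PartialOrder A] {t k q : A}

theorem supp_mul_supp (h : IsSupportInv t k q) : q * q = q := by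
  nth_rw 1 [← h.inv_mul]
  rw [mul_assoc, h.mul_supp, h.inv_mul]

theorem supp_mul (h : IsSupportInv t k q) : q * t = t := by
  rw [← h.mul_inv, mul_assoc, h.inv_mul, h.mul_supp]

theorem sq_mul_inv_sq (h : IsSupportInv t k q) : t * t * (k * k) = q := by
  rw [mul_assoc, ← mul_assoc t k, h.mul_inv, ← mul_assoc, h.mul_supp, h.mul_inv]

theorem sq_mul_supp (h : IsSupportInv t k q) : t * t * q = t * t := by
  rw [mul_assoc, h.mul_supp]

theorem inv_mul_sq_mul_inv (h : IsSupportInv t k q) : k * (t * t) * k = q := by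
  rw [← mul_assoc, mul_assoc, h.mul_inv, h.inv_mul, h.supp_mul_supp]

end IsSupportInv

variable {A B : Type*} [CStarAlgebra A] [PartialOrder A] [StarOrderedRing A]
  [CStarAlgebra B] [PartialOrder B] [StarOrderedRing B]
  {τA : A →ₗ[ℂ] ℂ} {τB : B →ₗ[ℂ] ℂ}

/-- The adjoint of a positive map is positive. -/
theorem map_nonneg_of_adjoint (hA : IsFaithfulTrace τA) (hB : IsFaithfulTrace τB)
    {T : A →ₗ[ℂ] B} {α : B →ₗ[ℂ] A} (hα : ∀ b, 0 ≤ b → 0 ≤ α b)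
    (hadj : ∀ a b, τA (α b * a) = τB (b * T a)) {a : A} (ha : 0 ≤ a) : 0 ≤ T a := by
  refine hB.nonneg_of_apply ?_ fun b hb => ?_
  -- Self-adjointness of `T a` has to come first, since positivity is tested only against positive
  -- elements.
  · refine hB.ext fun b => ?_
    rw [← star_star (b * star (T a)), hB.map_star, star_mul, star_star, hB.mul_comm (T a), ← hadj,
      ← hA.map_star, star_mul, map_star_of_map_nonneg hα, star_star, ha.isSelfAdjoint.star_eq,
      hA.mul_comm, hadj]
  · rw [hB.mul_comm, ← hadj]
    exact hA.apply_mul_nonneg (hα _ hb) ha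

section Recovery

variable {r s : A} {r' s' : B} {T : A →ₗ[ℂ] B} {α : B →ₗ[ℂ] A} {β : A →ₗ[ℂ] B}
  {t k q : A} {t' k' q' : B}

theorem isKMSDual_of_adjoint {A B : Type*} [CStarAlgebra A] [PartialOrder A] [CStarAlgebra B]
    [PartialOrder B] [StarOrderedRing B] {τA : A →ₗ[ℂ] ℂ} {τB : B →ₗ[ℂ] ℂ} {r s : A} {r' s' : B}
    {T : A →ₗ[ℂ] B} {α : B →ₗ[ℂ] A} {β : A →ₗ[ℂ] B}
    (hA : IsFaithfulTrace τA) (hB : IsFaithfulTrace τB) (hr : IsPosInv r s) (hr' : IsPosInv r' s') (hα : IsSchwarzMap α) (hβ : IsSchwarzMap β)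
    (hadj : ∀ a b, τA (α b * a) = τB (b * T a)) (hT : ∀ a, β a = s' * T (r * a * r) * s') :
    IsKMSDual τA τB r s r' s' α β where
  traceA := hA
  traceB := hB
  posA := hr
  posB := hr'
  schwarzA := hα
  schwarzB := hβ
  dual a b := by
    rw [hA.mul_comm, hadj, hB.mul_comm, hT]
    simp only [mul_assoc, hr'.mul_mul_cancel, hr'.symm.mul_mul_cancel]

theorem petz_eq_of_reversible [FiniteDimensional ℂ A] [FiniteDimensional ℂ B]
    (h : IsKMSDual τA τB r s r' s' α β)
    (hT : ∀ a, β a = s' * T (r * a * r) * s') {S : B →ₗ[ℂ] A} {γ : A →ₗ[ℂ] B}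
    (hγ : IsSchwarzMap γ) (hadj : ∀ a b, τB (γ a * b) = τA (a * S b))
    (hSρ : S (r' * r') = r * r) (ht : IsSupportInv t k q) (ht' : IsSupportInv t' k' q')
    (hTσ : T (t * t) = t' * t') (hSσ : S (T (t * t)) = t * t) (b : A) :
    k' * T (t * (q * b * q) * t) * k' = β (q * b * q) := by
  have hs := h.posA.symm
  have hTx : ∀ x, T x = r' * β (s * x * s) * r' := fun x => by
    rw [hT]
    simp only [mul_assoc, h.posA.mul_mul_cancel, h.posB.mul_mul_cancel, h.posA.inv_mul,
      h.posB.inv_mul, mul_one]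
  have hβd : β (s * (t * t) * s) = s' * (t' * t') * s' := by
    rw [← hTσ, hTx]
    simp only [mul_assoc, h.posB.symm.mul_mul_cancel, h.posB.mul_inv, mul_one]
  have hd : α (β (s * (t * t) * s)) = s * (t * t) * s := by
    refine h.fixed_of_reversed (γ := γ)
      -- `δ` is the Petz map of `S` at `T(ρ)`, unital because `S` recovers `ρ`.
      (δ := IsKMSDual.mulLeftRight s s ∘ₗ S ∘ₗ IsKMSDual.mulLeftRight r' r') hγ ?_ ?_ ?_ ?_
    · simp only [LinearMap.comp_apply, IsKMSDual.mulLeftRight_apply, mul_one, hSρ]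
      rw [mul_assoc, mul_assoc, h.posA.mul_inv, mul_one, hs.mul_inv]
    · intro b hb
      simp only [LinearMap.comp_apply, IsKMSDual.mulLeftRight_apply]
      have h1 := star_left_conjugate_nonneg hb r'
      rw [h.posB.star_left] at h1
      have h2 := star_left_conjugate_nonneg
        (map_nonneg_of_adjoint h.traceB h.traceA hγ.map_nonneg (fun b a => hadj a b) h1) s
      rwa [h.posA.star_right] at h2
    · intro a b
      simp only [LinearMap.comp_apply, IsKMSDual.mulLeftRight_apply]
      rw [show r * a * r * (s * S (r' * b * r') * s) = r * (a * S (r' * b * r') * s) by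
        simp only [mul_assoc, h.posA.mul_mul_cancel], h.traceA.mul_comm,
        h.posA.symm.mul_mul_cancel', ← hadj, h.traceB.apply_swap, h.traceB.mul_comm]
    · simp only [LinearMap.comp_apply, IsKMSDual.mulLeftRight_apply, hβd]
      rw [show r' * (s' * (t' * t') * s') * r' = t' * t' by
        simp only [mul_assoc, h.posB.mul_mul_cancel, h.posB.inv_mul, mul_one], ← hTσ, hSσ]
  obtain ⟨⟨hc, hβc⟩, hq, hβq⟩ := h.cocycle_and_support ht.nonneg ht'.nonneg ht.sq_mul_inv_sq
    ht.sq_mul_supp ht'.sq_mul_inv_sq ht'.sq_mul_supp hd hβd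
  have hc' := h.fixed_star hc
  have hβc' : β (star (s * t)) = t' * s' := by
    rw [h.schwarzB.map_star, hβc, star_mul, h.posB.star_right, ht'.nonneg.isSelfAdjoint.star_eq]
  rw [star_mul, hs.star_left, ht.nonneg.isSelfAdjoint.star_eq] at hc' hβc'
  -- `s (t b t) s = (s t) b (s t)*`, and both outer factors lie in the multiplicative domain of `β`.
  have hkey : T (t * b * t) = t' * β b * t' := by
    rw [hTx, show s * (t * b * t) * s = s * t * b * (t * s) by simp only [mul_assoc],
      h.map_mul_fixed hc', h.map_fixed_mul hc, hβc, hβc']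
    simp only [mul_assoc, h.posB.mul_mul_cancel, h.posB.inv_mul, mul_one]
  rw [show t * (q * b * q) * t = t * b * t by
    rw [← mul_assoc, ← mul_assoc, ht.mul_supp, mul_assoc _ q, ht.supp_mul], hkey,
    h.map_mul_fixed hq, h.map_fixed_mul hq, hβq]
  calc k' * (t' * β b * t') * k' = (k' * t') * β b * (t' * k') := by simp only [mul_assoc]
    _ = q' * β b * q' := by rw [ht'.inv_mul, ht'.mul_inv]

theorem reversed_of_petz_eq (hA : IsFaithfulTrace τA) (hB : IsFaithfulTrace τB)
    (hα : IsSchwarzMap α) (hβ : IsSchwarzMap β) (hadj : ∀ a b, τA (α b * a) = τB (b * T a))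
    {S : B →ₗ[ℂ] A} (hS : ∀ a b, τB (β a * b) = τA (a * S b)) (ht : IsSupportInv t k q)
    (ht' : IsSupportInv t' k' q') (hTσ : T (t * t) = t' * t')
    (heq : ∀ b, k' * T (t * (q * b * q) * t) * k' = β (q * b * q)) : S (T (t * t)) = t * t := by
  have hβq : β q = q' := by
    -- At `b = 1` the left side is `k' T(σ) k' = q'`. As `β q` is thus a projection, `q` lies in the
    -- multiplicative domain of `β`.
    have := heq 1
    rw [mul_one, ht.supp_mul_supp, ht.mul_supp, hTσ, ht'.inv_mul_sq_mul_inv] at this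
    exact this.symm
  have hr : ∀ a, β (a * q) = β a * q' := fun a => by
    rw [hβ.map_mul_of_map_star_mul_self, hβq]
    rw [ht.star_eq, ht.supp_mul_supp, hβq, ht'.star_eq, ht'.supp_mul_supp]
  have hl : ∀ a, β (q * a) = q' * β a := fun a => by
    rw [hβ.map_mul_of_map_mul_star_self, hβq]
    rw [ht.star_eq, ht.supp_mul_supp, hβq, ht'.star_eq, ht'.supp_mul_supp]
  have hq' : 0 ≤ 1 - q' := by
    have := star_mul_self_nonneg (1 - q')
    rwa [star_sub, star_one, ht'.star_eq, mul_sub, mul_one, sub_mul, one_mul, ht'.supp_mul_supp,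
      sub_self, sub_zero] at this
  have htt : 0 ≤ t * t := by
    have := star_mul_self_nonneg t
    rwa [ht.nonneg.isSelfAdjoint.star_eq] at this
  have h0 : α (1 - q') * (t * t) = 0 := by
    refine hA.mul_eq_zero_of_apply (hα.map_nonneg _ hq') htt ?_
    rw [hadj, hTσ, sub_mul, one_mul, ← mul_assoc, ht'.supp_mul, sub_self, map_zero]
  -- `τ(α(1 - q') σ) = τ((1 - q') T(σ)) = 0`, so the positive element `α(1 - q')` annihilates the
  -- support of `σ`.
  have hαq : α q' * t = t := by
    have h1 : α (1 - q') * t = 0 := by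
      calc α (1 - q') * t = α (1 - q') * (t * t) * k := by
            rw [mul_assoc, mul_assoc t, ht.mul_inv, ht.mul_supp]
        _ = 0 := by rw [h0, zero_mul]
    rw [map_sub, hα.map_one, sub_mul, one_mul, sub_eq_zero] at h1
    exact h1.symm
  refine hA.ext fun a => ?_
  have h1 : q' * (t' * t') * q' = t' * t' := by
    rw [← mul_assoc, ht'.supp_mul, mul_assoc, ht'.mul_supp]
  have h2 : t * (q * a * q) * t = t * a * t := by
    rw [← mul_assoc, ← mul_assoc, ht.mul_supp, mul_assoc _ q, ht.supp_mul]
  calc τA (a * S (T (t * t))) = τB (β a * (q' * (t' * t') * q')) := by rw [← hS, hTσ, h1]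
    _ = τB (β (q * a * q) * (t' * t')) := by
        rw [hr, hl, ← mul_assoc, hB.mul_comm]; simp only [mul_assoc]
    _ = τB (k' * (t' * t') * k' * T (t * a * t)) := by
        rw [← heq, h2, mul_assoc, mul_assoc, hB.mul_comm, hB.mul_comm _ (T _)]
        simp only [mul_assoc]
    _ = τA (α q' * t * (a * t)) := by
        rw [ht'.inv_mul_sq_mul_inv, ← hadj]; simp only [mul_assoc]
    _ = τA (a * (t * t)) := by rw [hαq, hA.mul_comm, mul_assoc]

end Recovery
end
end PetzRecovery

/-! ### Square roots and support projections of operators. -/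

namespace PetzRecovery
section
open scoped ComplexOrder

section Operator

/-- The spectrum is finite, so even `x ↦ (√x)⁻¹`, discontinuous at `0`, is admissible in the
functional calculus. -/
theorem continuousOn_spectrum {H : Type*} [NormedAddCommGroup H] [InnerProductSpace ℂ H]
    [FiniteDimensional ℂ H] (a : H →L[ℂ] H) (f : ℝ → ℝ) : ContinuousOn f (spectrum ℝ a) := by
  have h : (spectrum ℂ a).Finite := by
    rw [← AlgEquiv.spectrum_eq (Module.End.toContinuousLinearMap H).symm a]
    exact Module.End.finite_spectrum _
  refine Set.Finite.continuousOn ?_ f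
  rw [← spectrum.preimage_algebraMap ℂ]
  exact h.preimage (FaithfulSMul.algebraMap_injective ℝ ℂ).injOn

variable {H : Type*} [NormedAddCommGroup H] [InnerProductSpace ℂ H] [CompleteSpace H]

theorem sqrt_eq_cfc_real_sqrt {a : H →L[ℂ] H} (ha : 0 ≤ a) : CFC.sqrt a = cfc Real.sqrt a := by
  rw [CFC.sqrt_eq_real_sqrt a, cfcₙ_eq_cfc]

theorem isSelfAdjoint_invSqrt (a : H →L[ℂ] H) : IsSelfAdjoint (invSqrt a) :=
  cfc_predicate _ a

theorem invSqrt_mul_sqrt {a : H →L[ℂ] H} (ha : 0 ≤ a) :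
    invSqrt a * CFC.sqrt a = CFC.sqrt a * invSqrt a := by
  rw [sqrt_eq_cfc_real_sqrt ha]
  exact cfc_commute_cfc _ _ a

variable [FiniteDimensional ℂ H]

theorem sqrt_mul_invSqrt_mul_sqrt {a : H →L[ℂ] H} (ha : 0 ≤ a) :
    CFC.sqrt a * invSqrt a * CFC.sqrt a = CFC.sqrt a := by
  have hc := continuousOn_spectrum a
  rw [sqrt_eq_cfc_real_sqrt ha, invSqrt, ← cfc_mul _ _ a (hc _) (hc _),
    ← cfc_mul _ _ a (hc _) (hc _)]
  congr 1
  funext x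
  exact mul_inv_mul_cancel _

/-- The product is an orthogonal projection with the same kernel as `a`, each being a left multiple
of the other. -/
theorem sqrt_mul_invSqrt {a : H →L[ℂ] H} (ha : 0 ≤ a) : CFC.sqrt a * invSqrt a = supp a := by
  set q := CFC.sqrt a * invSqrt a with hq
  have hsa : IsStarProjection q := by
    refine ⟨?_, ?_⟩
    · rw [IsIdempotentElem, hq, ← mul_assoc, sqrt_mul_invSqrt_mul_sqrt ha]
    · rw [IsSelfAdjoint, hq, star_mul, star_sqrt, (isSelfAdjoint_invSqrt a).star_eq,
        invSqrt_mul_sqrt ha]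
  have h1 : a * q = a := by
    nth_rw 1 [← CFC.sqrt_mul_sqrt_self a]
    rw [hq, ← invSqrt_mul_sqrt ha, mul_assoc, ← mul_assoc _ (invSqrt a),
      sqrt_mul_invSqrt_mul_sqrt ha, CFC.sqrt_mul_sqrt_self a]
  have h2 : invSqrt a * invSqrt a * a = q := by
    have hc := invSqrt_mul_sqrt ha
    calc invSqrt a * invSqrt a * a
        = invSqrt a * (invSqrt a * CFC.sqrt a) * CFC.sqrt a := by
          nth_rw 3 [← CFC.sqrt_mul_sqrt_self a]
          simp only [mul_assoc]
      _ = invSqrt a * CFC.sqrt a * (invSqrt a * CFC.sqrt a) := by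
          nth_rw 1 [hc]; simp only [mul_assoc]
      _ = CFC.sqrt a * invSqrt a * CFC.sqrt a * invSqrt a := by rw [hc]; simp only [mul_assoc]
      _ = q := by rw [sqrt_mul_invSqrt_mul_sqrt ha]
  have hker : LinearMap.ker (a : H →ₗ[ℂ] H) = LinearMap.ker (q : H →ₗ[ℂ] H) := by
    ext x
    simp only [LinearMap.mem_ker, ContinuousLinearMap.coe_coe]
    constructor
    · intro h; rw [← h2, mul_apply_eq_comp, h, map_zero]
    · intro h; rw [← h1, mul_apply_eq_comp, h, map_zero]
  obtain ⟨K, hK, hqK⟩ := isStarProjection_iff_eq_starProjection.1 hsa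
  rw [hqK, Submodule.ker_starProjection] at hker
  rw [hqK, supp, Submodule.starProjection_inj, hker, Submodule.orthogonal_orthogonal]

end Operator
end
end PetzRecovery

/-! ### Transfer to *-subalgebras of `B(H)` and `B(K)`. -/

namespace PetzRecovery
section
open scoped ComplexOrder

variable {H K : Type*}
  [NormedAddCommGroup H] [InnerProductSpace ℂ H] [FiniteDimensional ℂ H] [CompleteSpace H]
  [NormedAddCommGroup K] [InnerProductSpace ℂ K] [FiniteDimensional ℂ K] [CompleteSpace K]
  {𝒜 : StarSubalgebra ℂ (H →L[ℂ] H)} {ℬ : StarSubalgebra ℂ (K →L[ℂ] K)}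

attribute [local instance] isClosed_coe

theorem sqrtIn_mul_self {σ : 𝒜} (hσ : 0 ≤ σ) : sqrtIn σ * sqrtIn σ = σ :=
  Subtype.ext (CFC.sqrt_mul_sqrt_self (σ : H →L[ℂ] H) hσ)

theorem sqrtIn_nonneg (σ : 𝒜) : 0 ≤ sqrtIn σ :=
  CFC.sqrt_nonneg (σ : H →L[ℂ] H)

theorem star_sqrtIn (σ : 𝒜) : star (sqrtIn σ) = sqrtIn σ :=
  Subtype.ext (star_sqrt (σ : H →L[ℂ] H))

/-- Square roots of positive elements stay in `𝒜`, so the order inherited from `B(H)` is the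
intrinsic one. -/
theorem starOrderedRing_coe : StarOrderedRing 𝒜 := by
  refine StarOrderedRing.of_nonneg_iff' (fun {x y} hxy z => ?_) (fun x => ⟨fun h => ?_, ?_⟩)
  · exact add_le_add_right (α := H →L[ℂ] H) hxy z
  · exact ⟨sqrtIn x, by rw [star_sqrtIn, sqrtIn_mul_self h]⟩
  · rintro ⟨s, rfl⟩
    exact star_mul_self_nonneg (s : H →L[ℂ] H)

attribute [local instance] starOrderedRing_coe

/-- The trace of `B(H)`, restricted to `𝒜`. -/
noncomputable def traceIn (𝒜 : StarSubalgebra ℂ (H →L[ℂ] H)) : 𝒜 →ₗ[ℂ] ℂ where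
  toFun a := opTrace (a : H →L[ℂ] H)
  map_add' a b := by simp [opTrace]
  map_smul' c a := by simp [opTrace]

theorem isFaithfulTrace_traceIn : IsFaithfulTrace (traceIn 𝒜) where
  mul_comm a b := LinearMap.trace_mul_comm ℂ _ _
  map_star a := opTrace_star (a : H →L[ℂ] H)
  nonneg a := by
    change 0 ≤ opTrace (star (a : H →L[ℂ] H) * (a : H →L[ℂ] H))
    rw [opTrace_star_mul_self (stdOrthonormalBasis ℂ H), Complex.zero_le_real]
    positivity
  faithful a h := (hsCore 𝒜).definite a h

theorem IsUnitalSchwarz.isSchwarzMap {Φ : 𝒜 →ₗ[ℂ] ℬ} (h : IsUnitalSchwarz Φ) : IsSchwarzMap Φ :=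
  ⟨h.1, h.2⟩

/-- A Schwarz map preserves adjoints, which turns the sesquilinear duality into a bilinear one. -/
theorem traceIn_hsAdjoint {T : 𝒜 →ₗ[ℂ] ℬ} (hT : IsUnitalSchwarz (hsAdjoint T)) (a : 𝒜) (b : ℬ) :
    traceIn 𝒜 (hsAdjoint T b * a) = traceIn ℬ (b * T a) := by
  have h : traceIn 𝒜 (star (hsAdjoint T (star b)) * a) = traceIn ℬ (star (star b) * T a) :=
    hsAdjoint_spec T (star b) a
  rwa [hT.isSchwarzMap.map_star, star_star, star_star] at h

theorem hsAdjoint_hsAdjoint (T : 𝒜 →ₗ[ℂ] ℬ) : hsAdjoint (hsAdjoint T) = T := by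
  refine LinearMap.ext fun a => isFaithfulTrace_traceIn.ext fun b => ?_
  have h1 : traceIn ℬ (star (hsAdjoint (hsAdjoint T) a) * star b) =
    traceIn 𝒜 (star a * hsAdjoint T (star b)) := hsAdjoint_spec (hsAdjoint T) a (star b)
  have h2 : traceIn 𝒜 (star (hsAdjoint T (star b)) * a) = traceIn ℬ (star (star b) * T a) :=
    hsAdjoint_spec T (star b) a
  rw [star_star] at h2
  have h3 := congrArg star h1
  rw [← isFaithfulTrace_traceIn.map_star, ← isFaithfulTrace_traceIn.map_star, star_mul, star_mul,
    star_star, star_star, star_star, h2] at h3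
  exact h3

theorem isSupportInv_sqrtIn {σ : 𝒜} (hσ : 0 ≤ σ) :
    IsSupportInv (sqrtIn σ) (invSqrtIn σ) (sqrtIn σ * invSqrtIn σ) := by
  have h1 : invSqrtIn σ * sqrtIn σ = sqrtIn σ * invSqrtIn σ := Subtype.ext (invSqrt_mul_sqrt hσ)
  refine ⟨sqrtIn_nonneg σ, ?_, rfl, h1, ?_⟩
  · have h2 : star (invSqrtIn σ) = invSqrtIn σ :=
      Subtype.ext (isSelfAdjoint_invSqrt (σ : H →L[ℂ] H)).star_eq
    rw [star_mul, star_sqrtIn, h2, h1]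
  · rw [← h1, ← mul_assoc]
    exact Subtype.ext (sqrt_mul_invSqrt_mul_sqrt hσ)

theorem isPosInv_sqrtIn {σ : 𝒜} (hσ : 0 ≤ σ) (hu : IsUnit σ) :
    IsPosInv (sqrtIn σ) (invSqrtIn σ) := by
  have h := isSupportInv_sqrtIn hσ
  have h1 : sqrtIn σ * invSqrtIn σ = 1 := by
    have h2 := h.sq_mul_supp
    rw [sqrtIn_mul_self hσ] at h2
    exact hu.mul_left_cancel (h2.trans (mul_one σ).symm)
  exact ⟨h.nonneg, h1, h.inv_mul.trans h1⟩

theorem eqOn_corner_iff {X : Type*} {σ : 𝒜} (hσ : 0 ≤ σ) {f g : 𝒜 → X} :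
    Set.EqOn f g (corner 𝒜 (supp (σ : H →L[ℂ] H))) ↔
      ∀ b : 𝒜, f (sqrtIn σ * invSqrtIn σ * b * (sqrtIn σ * invSqrtIn σ)) =
        g (sqrtIn σ * invSqrtIn σ * b * (sqrtIn σ * invSqrtIn σ)) := by
  have hq : ((sqrtIn σ * invSqrtIn σ : 𝒜) : H →L[ℂ] H) = supp (σ : H →L[ℂ] H) :=
    sqrt_mul_invSqrt hσ
  constructor
  · exact fun h b => h ⟨b, by rw [← hq]; rfl⟩
  · rintro h a ⟨b, hb⟩
    have : a = sqrtIn σ * invSqrtIn σ * b * (sqrtIn σ * invSqrtIn σ) :=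
      Subtype.ext (by rw [hb, ← hq]; rfl)
    rw [this]
    exact h b

end
end PetzRecovery

open PetzRecovery in
theorem mainTheorem9 {H K : Type*}
    [NormedAddCommGroup H] [InnerProductSpace ℂ H] [FiniteDimensional ℂ H] [CompleteSpace H]
    [NormedAddCommGroup K] [InnerProductSpace ℂ K] [FiniteDimensional ℂ K] [CompleteSpace K]
    (𝒜 : StarSubalgebra ℂ (H →L[ℂ] H)) (ℬ : StarSubalgebra ℂ (K →L[ℂ] K))
    (T : 𝒜 →ₗ[ℂ] ℬ) (𝒮 : Set 𝒜) (h𝒮 : 𝒮 ⊆ PetzRecovery.densities 𝒜)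
    (ρ : 𝒜) (hρ : ρ ∈ 𝒮) (hρ_inv : IsUnit ρ) (hTρ_inv : IsUnit (T ρ))
    (hT : PetzRecovery.IsUnitalSchwarz (PetzRecovery.hsAdjoint T))
    (hTρ : PetzRecovery.IsUnitalSchwarz (PetzRecovery.petz T ρ)) :
    PetzRecovery.IsReversible T 𝒮 ↔
      ∀ σ ∈ 𝒮, Set.EqOn (PetzRecovery.petz T σ) (PetzRecovery.petz T ρ)
        (PetzRecovery.corner 𝒜 (PetzRecovery.supp (σ : H →L[ℂ] H))) := by
  have := isClosed_coe 𝒜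
  have := isClosed_coe ℬ
  have := starOrderedRing_coe (𝒜 := 𝒜)
  have := starOrderedRing_coe (𝒜 := ℬ)
  have hτA := isFaithfulTrace_traceIn (𝒜 := 𝒜)
  have hτB := isFaithfulTrace_traceIn (𝒜 := ℬ)
  have hα := hT.isSchwarzMap
  have hβ := hTρ.isSchwarzMap
  have hadj := traceIn_hsAdjoint hT
  have hpos : ∀ σ ∈ 𝒮, 0 ≤ σ := fun σ hσ => (h𝒮 hσ).1
  have hTpos : ∀ σ ∈ 𝒮, 0 ≤ T σ := fun σ hσ =>
    map_nonneg_of_adjoint hτA hτB hα.map_nonneg hadj (hpos σ hσ)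
  have hsq : ∀ σ ∈ 𝒮, T (sqrtIn σ * sqrtIn σ) = sqrtIn (T σ) * sqrtIn (T σ) := fun σ hσ => by
    rw [sqrtIn_mul_self (hpos σ hσ), sqrtIn_mul_self (hTpos σ hσ)]
  constructor
  · rintro ⟨S, hS, hrev⟩ σ hσ
    have hdual := isKMSDual_of_adjoint hτA hτB (isPosInv_sqrtIn (hpos ρ hρ) hρ_inv)
      (isPosInv_sqrtIn (hTpos ρ hρ) hTρ_inv) hα hβ hadj fun a => rfl
    rw [eqOn_corner_iff (hpos σ hσ)]
    refine petz_eq_of_reversible hdual (fun a => rfl) hS.isSchwarzMap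
      (fun a b => traceIn_hsAdjoint hS b a) ?_
      (isSupportInv_sqrtIn (hpos σ hσ)) (isSupportInv_sqrtIn (hTpos σ hσ)) (hsq σ hσ) ?_
    · rw [sqrtIn_mul_self (hTpos ρ hρ), sqrtIn_mul_self (hpos ρ hρ), hrev ρ hρ]
    · rw [sqrtIn_mul_self (hpos σ hσ), hrev σ hσ]
  · intro h
    have hS : IsUnitalSchwarz (hsAdjoint (hsAdjoint (petz T ρ))) := by
      rwa [hsAdjoint_hsAdjoint]
    -- The recovery map is independent of `σ`; its adjoint is `T_ρ`, a unital Schwarz map by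
    -- hypothesis.
    refine ⟨hsAdjoint (petz T ρ), hS, fun σ hσ => ?_⟩
    have hSadj : ∀ a b, traceIn ℬ (petz T ρ a * b) = traceIn 𝒜 (a * hsAdjoint (petz T ρ) b) :=
      fun a b => by
        rw [← traceIn_hsAdjoint hS, hsAdjoint_hsAdjoint]
    have := reversed_of_petz_eq hτA hτB hα hβ hadj hSadj
      (isSupportInv_sqrtIn (hpos σ hσ)) (isSupportInv_sqrtIn (hTpos σ hσ)) (hsq σ hσ)
      ((eqOn_corner_iff (hpos σ hσ)).1 (h σ hσ))
    rwa [sqrtIn_mul_self (hpos σ hσ)] at this
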